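/- Let $\Omega\subsetneq\mathbb{R}^n$ be an open convex set with finite inradius $\delta_0=\sup_{x\in\Omega}\delta(x)<\infty$, where $\delta(x)=\operatorname{dist}(x,\partial\Omega)$. Let $p\ge 1$, $m>1$, $\nu\in[0,1/m]$ and $\lambda\in[0,\tfrac{1+\nu m}{2})$. Let $J_\nu(x)=\sum_{k\ge0}\frac{(-1)^k(x/2)^{2k+\nu}}{k!\,\Gamma(k+1+\nu)}$ be the Bessel function of order $\nu$. It has a first positive zero $j_\nu$, and the parametric Lamb equation $$(1-2\lambda)J_\nu\!\left(\tfrac{2}{m}c\right)+2c\,J_\nu'\!\left(\tfrac{2}{m}c\right)=0,\qquad \tfrac{2}{m}c\in(0,j_\nu),$$ has a smallest root $c=c_\nu(m)$. For every $f\in C_0^1(\Omega)$ (real-valued, continuously differentiable, with compact support contained in $\Omega$), $$(1-p\nu^2m^2)\int_\Omega\frac{|f(x)|^p}{\delta(x)^2}\,dx+\frac{4p\left(c_\nu(m)^2+(m-1)(\lambda-\lambda^2)\right)}{\delta_0^m}\int_\Omega\frac{|f(x)|^p}{\delta(x)^{2-m}}\,dx\le p^p\left(2(1+\nu m)-4\lambda^2\right)^p\int_\Omega\frac{|\nabla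 f(x)|^p}{\delta(x)^{2-p}}\,dx,$$ and, if moreover $\nu<1/m$, $$\int_\Omega\frac{|f(x)|^p}{\delta(x)^2}\,dx+\frac{4p\left(c_\nu(m)^2+(m-1)(\lambda-\lambda^2)\right)}{(1-\nu^2m^2)\,\delta_0^m}\int_\Omega\frac{|f(x)|^p}{\delta(x)^{2-m}}\,dx\le p^p\left(\frac{2}{1-\nu m}-\frac{4\lambda^2}{1-\nu^2m^2}\right)^p\int_\Omega\frac{|\nabla f(x)|^p}{\delta(x)^{2-p}}\,dx.$$ -/

import Mathlib

open MeasureTheory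
open scoped Gradient

noncomputable section

/-- The Bessel function of the first kind `J_ν(x)` of real order `ν`, for `x ≥ 0`, given by
its power series. -/
def besselJ (ν x : ℝ) : ℝ :=
  ∑' k : ℕ, (-1) ^ k * (x / 2) ^ (2 * (k : ℝ) + ν) /
    ((Nat.factorial k : ℝ) * Real.Gamma ((k : ℝ) + 1 + ν))

/-- The set of positive zeros of `J_ν`. -/
def besselPosZeros (ν : ℝ) : Set ℝ := {x : ℝ | 0 < x ∧ besselJ ν x = 0}

/-- `j_ν`, the first positive zero of `J_ν`. -/
def besselFirstZero (ν : ℝ) : ℝ := sInf (besselPosZeros ν)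

/-- The roots `c` of the parametric Lamb equation
`(1 - 2λ) J_ν(2c/m) + 2c J_ν'(2c/m) = 0` with `2c/m ∈ (0, j_ν)`. -/
def lambRoots (ν m lam : ℝ) : Set ℝ :=
  {c : ℝ | 2 / m * c ∈ Set.Ioo 0 (besselFirstZero ν) ∧
    (1 - 2 * lam) * besselJ ν (2 / m * c) + 2 * c * deriv (besselJ ν) (2 / m * c) = 0}

/-- The Lamb constant `c_ν(m)` (for the parameter `λ`): the first root of the parametric
Lamb equation. -/
def lambConstant (ν m lam : ℝ) : ℝ := sInf (lambRoots ν m lam)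

/-- The distance `δ(x) = dist(x, ∂Ω)` to the boundary of `Ω`. -/
def bdryDist {n : ℕ} (Ω : Set (EuclideanSpace ℝ (Fin n))) (x : EuclideanSpace ℝ (Fin n)) : ℝ :=
  Metric.infDist x (frontier Ω)

/-- `Ω` has finite inradius. -/
def FiniteInradius {n : ℕ} (Ω : Set (EuclideanSpace ℝ (Fin n))) : Prop :=
  BddAbove (bdryDist Ω '' Ω)

/-- The inradius `δ₀(Ω) = sup {δ(x) : x ∈ Ω}`. -/
def inradius {n : ℕ} (Ω : Set (EuclideanSpace ℝ (Fin n))) : ℝ :=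
  sSup (bdryDist Ω '' Ω)

/-- `f ∈ C₀¹(Ω)`: `f` is continuously differentiable with compact support contained in `Ω`
(functions on `Ω` being extended by zero). -/
structure IsC01 {n : ℕ} (Ω : Set (EuclideanSpace ℝ (Fin n)))
    (f : EuclideanSpace ℝ (Fin n) → ℝ) : Prop where
  contDiff : ContDiff ℝ 1 f
  hasCompactSupport : HasCompactSupport f
  tsupport_subset : tsupport f ⊆ Ω

end

/-!
The inequality is the integrated form of a one-dimensional bound, combined with the superharmonicity
of the distance function of a convex domain.

Put `s = 1 - ν²m²`, `K = c² + (m-1)(λ-λ²)` and `A = 2(1+νm) - 4λ²`. The one-dimensional bound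
(`lamb_bound`) is `s(1-t) + 4K/(m-1) (t - t^m) ≤ A` on `(0,1]`. The logarithmic derivative
`Y'/Y = ψ/t` of `Y(t) = √t J_ν((2c/m) t^{m/2})` solves the Riccati equation
`(Y'/Y)' + (Y'/Y)² + s/(4t²) + c²t^{m-2} = 0`, and `λ ≤ ψ ≤ (1+νm)/2` on `(0,1]` with `ψ(1) = λ`,
since `c` is the first root of the Lamb equation. Integrating the Riccati equation over `[t,1]` and
using these bounds for `ψ` gives the claim. All facts about `J_ν` come from the entire functions
`E_ν(y) = ∑ (-1)^k y^k/(k! Γ(k+1+ν))`, which satisfy `E_ν' = -E_{ν+1}` and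
`y E_{ν+2} = (ν+1) E_{ν+1} - E_ν`. A positive zero of `E_ν` exists because the Riccati equation for
`y E_{ν+1}/E_ν` has no global solution (`exists_besselSeries_eq_zero`).

For the passage to `Ω`, the distance `δ` to the complement is concave on `Ω`, hence weakly
superharmonic: `∫ ⟪∇δ, ∇φ⟫ ≥ 0` for compactly supported Lipschitz `φ ≥ 0`
(`integral_lineDeriv_mul_lineDeriv_nonneg`). Take `φ = |f|^p G(δ)`, where `G` is the function with
`-G' = s/t² + 4K t^{m-2}/δ₀^m` that vanishes at `δ₀`. The one-dimensional bound says `δ G(δ) ≤ A`,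
and `|∇δ| = 1` almost everywhere, so that
`∫ |f|^p (s/δ² + 4K δ^{m-2}/δ₀^m) ≤ ∫ p |f|^{p-1} |∇f| A/δ`. Young's inequality on the right,
applied with the given `s` or after division of `s`, `K`, `A` by `s`, gives the two inequalities
(`hardy_of_bound`).
-/

/-! ### The entire function behind `J_ν` -/

/-- The entire function `E_ν(y) = ∑ (-1)^k y^k / (k! Γ(k+1+ν))`, for which
`J_ν(z) = (z/2)^ν E_ν((z/2)²)` when `z > 0`. -/
noncomputable def besselSeries (ν y : ℝ) : ℝ :=
  ∑' k : ℕ, (-1) ^ k * y ^ k / ((Nat.factorial k : ℝ) * Real.Gamma ((k : ℝ) + 1 + ν))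

lemma Gamma_le_Gamma_natCast_add {ν : ℝ} (hν : 0 ≤ ν) (k : ℕ) :
    Real.Gamma (1 + ν) ≤ Real.Gamma ((k : ℝ) + 1 + ν) := by
  induction k with
  | zero => simp
  | succ k ih =>
    have h : ((k + 1 : ℕ) : ℝ) + 1 + ν = ((k : ℝ) + 1 + ν) + 1 := by push_cast; ring
    have hk : (0 : ℝ) ≤ k := k.cast_nonneg
    rw [h, Real.Gamma_add_one (by positivity)]
    have := Real.Gamma_pos_of_pos (show (0 : ℝ) < k + 1 + ν by positivity)
    nlinarith

lemma besselSeries_term_bound {ν : ℝ} (hν : 0 ≤ ν) (y : ℝ) (k : ℕ) :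
    ‖(-1) ^ k * y ^ k / ((Nat.factorial k : ℝ) * Real.Gamma ((k : ℝ) + 1 + ν))‖ ≤
      |y| ^ k / (Nat.factorial k : ℝ) / Real.Gamma (1 + ν) := by
  have h0 : 0 < Real.Gamma (1 + ν) := Real.Gamma_pos_of_pos (by positivity)
  have h1 := Gamma_le_Gamma_natCast_add hν k
  have h2 : (0 : ℝ) < Nat.factorial k := by exact_mod_cast Nat.factorial_pos k
  rw [norm_div, norm_mul, norm_pow, norm_neg, norm_one, one_pow, one_mul, norm_pow,
    Real.norm_eq_abs, Real.norm_of_nonneg (by positivity), div_div]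
  gcongr

lemma summable_besselSeries {ν : ℝ} (hν : 0 ≤ ν) (y : ℝ) :
    Summable fun k : ℕ =>
      (-1) ^ k * y ^ k / ((Nat.factorial k : ℝ) * Real.Gamma ((k : ℝ) + 1 + ν)) :=
  .of_norm_bounded ((Real.summable_pow_div_factorial |y|).div_const _)
    (besselSeries_term_bound hν y)

lemma hasDerivAt_besselSeries {ν : ℝ} (hν : 0 ≤ ν) (y : ℝ) :
    HasDerivAt (besselSeries ν) (-besselSeries (ν + 1) y) y := by
  set R : ℝ := |y| + 1 with hR
  have hR0 : 0 < R := by positivity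
  have hu0 : Summable fun k : ℕ => (k : ℝ) * R ^ (k - 1) / (Nat.factorial k : ℝ) := by
    rw [← summable_nat_add_iff 1]
    refine (Real.summable_pow_div_factorial R).congr fun k => ?_
    rw [Nat.factorial_succ, Nat.add_sub_cancel]
    push_cast
    field_simp
  have hu := hu0.div_const (Real.Gamma (1 + ν))
  have hder : ∀ (k : ℕ), ∀ x ∈ Metric.ball (0 : ℝ) R, HasDerivAt
      (fun x : ℝ => (-1) ^ k * x ^ k / ((Nat.factorial k : ℝ) * Real.Gamma ((k : ℝ) + 1 + ν)))
      ((-1) ^ k * (k * x ^ (k - 1)) / ((Nat.factorial k : ℝ) * Real.Gamma ((k : ℝ) + 1 + ν))) x :=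
    fun k x _ => ((hasDerivAt_pow k x).const_mul _).div_const _
  have hbound : ∀ (k : ℕ), ∀ x ∈ Metric.ball (0 : ℝ) R,
      ‖(-1) ^ k * (k * x ^ (k - 1)) / ((Nat.factorial k : ℝ) * Real.Gamma ((k : ℝ) + 1 + ν))‖ ≤
        (k : ℝ) * R ^ (k - 1) / (Nat.factorial k : ℝ) / Real.Gamma (1 + ν) := by
    intro k x hx
    have h0 : 0 < Real.Gamma (1 + ν) := Real.Gamma_pos_of_pos (by positivity)
    have h1 := Gamma_le_Gamma_natCast_add hν k
    have h2 : (0 : ℝ) < Nat.factorial k := by exact_mod_cast Nat.factorial_pos k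
    have h3 : |x| ≤ R := by simpa using (mem_ball_zero_iff.1 hx).le
    rw [norm_div, norm_mul, norm_pow, norm_neg, norm_one, one_pow, one_mul, norm_mul, norm_pow,
      Real.norm_eq_abs x, Real.norm_of_nonneg (Nat.cast_nonneg k),
      Real.norm_of_nonneg (by positivity), div_div]
    gcongr
  have hyR : y ∈ Metric.ball (0 : ℝ) R := by simp [hR]
  have key := hasDerivAt_tsum_of_isPreconnected hu Metric.isOpen_ball
    (convex_ball (0 : ℝ) R).isPreconnected hder hbound (Metric.mem_ball_self hR0)
    (summable_besselSeries hν 0) hyR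
  refine key.congr_deriv ?_
  have hs : Summable fun k : ℕ => (-1) ^ k * ((k : ℝ) * y ^ (k - 1)) /
      ((Nat.factorial k : ℝ) * Real.Gamma ((k : ℝ) + 1 + ν)) := by
    refine (summable_nat_add_iff 1).1
      ((summable_besselSeries (ν := ν + 1) (by linarith) y).neg.congr fun k => ?_)
    rw [Nat.factorial_succ, Nat.add_sub_cancel, show ((k + 1 : ℕ) : ℝ) + 1 + ν = k + 1 + (ν + 1) by
      push_cast; ring]
    push_cast
    field_simp
    ring
  rw [hs.tsum_eq_zero_add, besselSeries, ← tsum_neg]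
  simp only [CharP.cast_eq_zero, zero_mul, mul_zero, zero_div, zero_add]
  refine tsum_congr fun k => ?_
  rw [Nat.factorial_succ, Nat.add_sub_cancel, show ((k + 1 : ℕ) : ℝ) + 1 + ν = k + 1 + (ν + 1) by
      push_cast; ring]
  push_cast
  field_simp
  ring

lemma continuous_besselSeries {ν : ℝ} (hν : 0 ≤ ν) : Continuous (besselSeries ν) :=
  continuous_iff_continuousAt.2 fun y => (hasDerivAt_besselSeries hν y).continuousAt

/-- The three-term recurrence of the Bessel functions. -/
lemma besselSeries_recurrence {ν : ℝ} (hν : 0 ≤ ν) (y : ℝ) :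
    y * besselSeries (ν + 2) y = (ν + 1) * besselSeries (ν + 1) y - besselSeries ν y := by
  have h0 := summable_besselSeries hν y
  have h1 := summable_besselSeries (ν := ν + 1) (by linarith) y
  have hstep : ∀ k : ℕ, Real.Gamma (k + 1 + (ν + 1)) = (k + 1 + ν) * Real.Gamma (k + 1 + ν) := by
    intro k
    rw [← Real.Gamma_add_one (by positivity)]
    ring_nf
  have hG : ∀ k : ℕ, Real.Gamma (k + 1 + ν) ≠ 0 := fun k =>
    (Real.Gamma_pos_of_pos (by positivity)).ne'
  rw [besselSeries, besselSeries, besselSeries, ← tsum_mul_left, ← tsum_mul_left,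
    ← (h1.mul_left _).tsum_sub h0, ((h1.mul_left _).sub h0).tsum_eq_zero_add]
  have hz : (ν + 1) * ((-1) ^ 0 * y ^ 0 / ((Nat.factorial 0 : ℝ) *
      Real.Gamma (((0 : ℕ) : ℝ) + 1 + (ν + 1)))) -
      (-1) ^ 0 * y ^ 0 / ((Nat.factorial 0 : ℝ) * Real.Gamma (((0 : ℕ) : ℝ) + 1 + ν)) = 0 := by
    have := hG 0
    rw [hstep 0]
    simp only [CharP.cast_eq_zero, zero_add] at this ⊢
    field_simp
    simp [add_comm]
  rw [hz, zero_add]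
  refine tsum_congr fun k => ?_
  have h2 := hG (k + 1)
  have h3 : ((k : ℝ) + 2 + ν) ≠ 0 := by positivity
  have e1 : Real.Gamma ((k : ℝ) + 1 + (ν + 2)) = (k + 2 + ν) * Real.Gamma (((k + 1 : ℕ) : ℝ) + 1 + ν) := by
    have := hstep (k + 1)
    push_cast at this ⊢
    rw [show (k : ℝ) + 1 + (ν + 2) = k + 1 + 1 + (ν + 1) by ring, this]
    ring
  rw [hstep (k + 1), e1, Nat.factorial_succ]
  push_cast at h2 ⊢
  have h4 : ((k : ℝ) + 1 + 1 + ν) ≠ 0 := by positivity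
  have h5 : ((Nat.factorial k : ℕ) : ℝ) ≠ 0 := by positivity
  field_simp
  ring

lemma besselSeries_zero_pos {ν : ℝ} (hν : 0 ≤ ν) : 0 < besselSeries ν 0 := by
  rw [besselSeries, tsum_eq_single 0 (fun k hk => by simp [hk])]
  have := Real.Gamma_pos_of_pos (show 0 < 1 + ν by positivity)
  simpa using this

lemma besselJ_eq {ν z : ℝ} (hz : 0 < z) :
    besselJ ν z = (z / 2) ^ ν * besselSeries ν ((z / 2) ^ 2) := by
  have h : 0 < z / 2 := by positivity
  rw [besselJ, besselSeries, ← tsum_mul_left]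
  refine tsum_congr fun k => ?_
  rw [Real.rpow_add h, show (2 : ℝ) * k = ((2 * k : ℕ) : ℝ) by push_cast; ring, Real.rpow_natCast,
    pow_mul]
  ring

lemma besselJ_eq_zero_iff {ν z : ℝ} (hz : 0 < z) :
    besselJ ν z = 0 ↔ besselSeries ν ((z / 2) ^ 2) = 0 := by
  rw [besselJ_eq hz, mul_eq_zero, or_iff_right]
  exact (Real.rpow_pos_of_pos (by positivity) _).ne'

/-- `z J_ν'(z)` in terms of the entire functions `E_ν` and `E_{ν+1}`. -/
lemma mul_deriv_besselJ {ν z : ℝ} (hν : 0 ≤ ν) (hz : 0 < z) :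
    z * deriv (besselJ ν) z = (z / 2) ^ ν *
      (ν * besselSeries ν ((z / 2) ^ 2) - 2 * (z / 2) ^ 2 * besselSeries (ν + 1) ((z / 2) ^ 2)) := by
  have h : 0 < z / 2 := by positivity
  have hd : HasDerivAt (fun x : ℝ => x / 2) (1 / 2) z := (hasDerivAt_id z).div_const 2
  have h1 : HasDerivAt (fun x : ℝ => (x / 2) ^ ν) _ z := hd.rpow_const (p := ν) (Or.inl h.ne')
  have h2 := (hasDerivAt_besselSeries hν ((z / 2) ^ 2)).comp z (hd.pow 2)
  have h3 := h1.mul h2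
  have h4 : besselJ ν =ᶠ[nhds z] fun x => (x / 2) ^ ν * besselSeries ν ((x / 2) ^ 2) := by
    filter_upwards [lt_mem_nhds hz] with x hx using besselJ_eq hx
  have h5 := (h3.congr_of_eventuallyEq h4).deriv
  rw [h5, Real.rpow_sub_one h.ne']
  simp only [Function.comp, Pi.pow_apply]
  push_cast
  field_simp
  ring

/-! ### The first positive zero -/

/-- `y^{ν+1} E_{ν+1}(y)` is a primitive of `y^ν E_ν(y)`. -/
lemma hasDerivAt_rpow_mul_besselSeries {ν y : ℝ} (hν : 0 ≤ ν) (hy : 0 < y) :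
    HasDerivAt (fun y => y ^ (ν + 1) * besselSeries (ν + 1) y) (y ^ ν * besselSeries ν y) y := by
  have h1 := (Real.hasDerivAt_rpow_const (x := y) (p := ν + 1) (Or.inl hy.ne')).mul
    (hasDerivAt_besselSeries (ν := ν + 1) (by linarith) y)
  convert! h1 using 1
  have h2 := besselSeries_recurrence hν y
  rw [show ν + 1 + 1 = ν + 2 by ring, Real.rpow_add_one hy.ne', add_sub_cancel_right]
  linear_combination (y ^ ν) * h2

/-- `E_{ν+1} > 0` up to and including the first positive zero of `E_ν`. -/
lemma besselSeries_succ_pos {ν Y : ℝ} (hν : 0 ≤ ν) (hY : 0 < Y)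
    (hpos : ∀ y ∈ Set.Ioo 0 Y, 0 < besselSeries ν y) : 0 < besselSeries (ν + 1) Y := by
  have hmono : StrictMonoOn (fun y => y ^ (ν + 1) * besselSeries (ν + 1) y) (Set.Icc 0 Y) := by
    refine strictMonoOn_of_deriv_pos (convex_Icc 0 Y) ?_ fun y hy => ?_
    · exact ((Real.continuous_rpow_const (by linarith)).mul
        (continuous_besselSeries (by linarith))).continuousOn
    · rw [interior_Icc] at hy
      rw [(hasDerivAt_rpow_mul_besselSeries hν hy.1).deriv]
      exact mul_pos (Real.rpow_pos_of_pos hy.1 _) (hpos y hy)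
  have h := hmono (Set.left_mem_Icc.2 hY.le) (Set.right_mem_Icc.2 hY.le) hY
  simp only [Real.zero_rpow (show ν + 1 ≠ 0 by linarith), zero_mul] at h
  exact pos_of_mul_pos_right h (Real.rpow_nonneg hY.le _)

/-- The Riccati equation for `r(y) = y E_{ν+1}(y) / E_ν(y)`, that is for
`r = (ν - z J_ν'(z) / J_ν(z)) / 2` with `y = z² / 4`. -/
lemma hasDerivAt_besselRatio {ν y : ℝ} (hν : 0 ≤ ν) (hy : 0 < y) (h0 : besselSeries ν y ≠ 0) :
    HasDerivAt (fun y => y * besselSeries (ν + 1) y / besselSeries ν y)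
      ((y - ν * (y * besselSeries (ν + 1) y / besselSeries ν y) +
        (y * besselSeries (ν + 1) y / besselSeries ν y) ^ 2) / y) y := by
  have h1 := ((hasDerivAt_id y).mul (hasDerivAt_besselSeries (ν := ν + 1) (by linarith) y)).div
    (hasDerivAt_besselSeries hν y) h0
  convert! h1 using 1
  have h2 := besselSeries_recurrence hν y
  rw [show ν + 1 + 1 = ν + 2 by ring]
  simp only [id, Pi.mul_apply]
  field_simp
  linear_combination (besselSeries ν y) * h2

/-- If `E_ν` had no positive zero, then `τ = 2r - ν` would be a global solution of
`2yτ' = 4y + τ² - ν²`, whose solutions blow up in finite time. -/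
lemma exists_besselSeries_eq_zero {ν : ℝ} (hν : 0 ≤ ν) (hν1 : ν ≤ 1) :
    ∃ y, 0 < y ∧ besselSeries ν y = 0 := by
  by_contra! hne
  set τ : ℝ → ℝ := fun y => 2 * (y * besselSeries (ν + 1) y / besselSeries ν y) - ν with hτ
  have hder : ∀ y, 0 < y → HasDerivAt (fun y => Real.arctan (τ y) - Real.log y / 2)
      ((1 / (1 + τ y ^ 2)) * ((4 * y + τ y ^ 2 - ν ^ 2) / (2 * y)) - y⁻¹ / 2) y := by
    intro y hy
    have h := (((hasDerivAt_besselRatio hν hy (hne y hy)).const_mul 2).sub_const ν).arctan.sub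
      ((Real.hasDerivAt_log hy.ne').div_const 2)
    convert! h using 2
    congr 1
    simp only [hτ]
    field_simp
    ring
  have hmono : MonotoneOn (fun y => Real.arctan (τ y) - Real.log y / 2) (Set.Ici 1) := by
    refine monotoneOn_of_deriv_nonneg (convex_Ici 1)
      (fun y hy => (hder y (one_pos.trans_le hy)).continuousAt.continuousWithinAt) ?_ ?_
    · intro y hy
      rw [interior_Ici] at hy
      exact (hder y (one_pos.trans hy)).differentiableAt.differentiableWithinAt
    · intro y hy
      rw [interior_Ici] at hy
      have hy1 : (1 : ℝ) < y := hy
      have hy0 : 0 < y := one_pos.trans hy1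
      rw [(hder y hy0).deriv]
      have h1 : (1 + τ y ^ 2) / (2 * y) ≤ (4 * y + τ y ^ 2 - ν ^ 2) / (2 * y) := by
        gcongr
        nlinarith
      have h2 : 0 < 1 + τ y ^ 2 := by positivity
      have h3 := mul_le_mul_of_nonneg_left h1 (by positivity : 0 ≤ 1 / (1 + τ y ^ 2))
      have h4 : 1 / (1 + τ y ^ 2) * ((1 + τ y ^ 2) / (2 * y)) = y⁻¹ / 2 := by
        field_simp
      linarith
  have h := hmono (Set.mem_Ici.2 le_rfl)
    (Set.mem_Ici.2 (Real.one_le_exp (by positivity : 0 ≤ 2 * Real.pi)))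
    (Real.one_le_exp (by positivity : 0 ≤ 2 * Real.pi))
  simp only [Real.log_one, Real.log_exp] at h
  have h1 := Real.arctan_lt_pi_div_two (τ (Real.exp (2 * Real.pi)))
  have h2 := Real.neg_pi_div_two_lt_arctan (τ 1)
  linarith

lemma isLeast_besselFirstZero {ν : ℝ} (hν : 0 ≤ ν) (hν1 : ν ≤ 1) :
    IsLeast (besselPosZeros ν) (besselFirstZero ν) := by
  have hset : besselPosZeros ν = Set.Ici 0 ∩ {x | besselSeries ν ((x / 2) ^ 2) = 0} := by
    ext x
    simp only [besselPosZeros, Set.mem_ofPred_eq, Set.mem_inter_iff, Set.mem_Ici]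
    constructor
    · rintro ⟨hx, h⟩
      exact ⟨hx.le, (besselJ_eq_zero_iff hx).1 h⟩
    · rintro ⟨hx, h⟩
      rcases hx.eq_or_lt with rfl | hx
      · have := besselSeries_zero_pos hν
        norm_num at h
        exact absurd h this.ne'
      · exact ⟨hx, (besselJ_eq_zero_iff hx).2 h⟩
  have hbdd : BddBelow (besselPosZeros ν) := ⟨0, fun x hx => hx.1.le⟩
  refine ⟨IsClosed.csInf_mem ?_ ?_ hbdd, fun x hx => csInf_le hbdd hx⟩
  · rw [hset]
    exact isClosed_Ici.inter (isClosed_eq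
      ((continuous_besselSeries hν).comp (by fun_prop)) continuous_const)
  · obtain ⟨y, hy, h⟩ := exists_besselSeries_eq_zero hν hν1
    have hs : (2 * √y / 2) ^ 2 = y := by
      rw [mul_div_cancel_left₀ _ two_ne_zero, Real.sq_sqrt hy.le]
    have hp : 0 < 2 * √y := by positivity
    exact ⟨2 * √y, hp, (besselJ_eq_zero_iff hp).2 (by rw [hs, h])⟩

/-- A continuous function positive at `0` and without zeros in `(0, Y)` is positive there. -/
lemma pos_of_forall_ne_zero {g : ℝ → ℝ} (hg : Continuous g) (h0 : 0 < g 0) {Y : ℝ}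
    (hne : ∀ y ∈ Set.Ioo 0 Y, g y ≠ 0) {y : ℝ} (hy : y ∈ Set.Ico 0 Y) : 0 < g y := by
  by_contra! hle
  obtain ⟨x, hx, hx0⟩ := intermediate_value_Icc' hy.1 hg.continuousOn ⟨hle, h0.le⟩
  have hx1 : x ≠ 0 := by
    rintro rfl
    exact h0.ne' hx0
  exact hne x ⟨lt_of_le_of_ne hx.1 hx1.symm, hx.2.trans_lt hy.2⟩ hx0

lemma besselSeries_pos {ν y : ℝ} (hν : 0 ≤ ν) (hν1 : ν ≤ 1)
    (hy : y ∈ Set.Ico 0 ((besselFirstZero ν / 2) ^ 2)) : 0 < besselSeries ν y := by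
  refine pos_of_forall_ne_zero (continuous_besselSeries hν) (besselSeries_zero_pos hν)
    (fun x hx h => ?_) hy
  have hs : (2 * √x / 2) ^ 2 = x := by
    rw [mul_div_cancel_left₀ _ two_ne_zero, Real.sq_sqrt hx.1.le]
  have hp : 0 < 2 * √x := mul_pos two_pos (Real.sqrt_pos.2 hx.1)
  have hj := isLeast_besselFirstZero hν hν1
  have h1 : besselFirstZero ν ≤ 2 * √x :=
    hj.2 ⟨hp, (besselJ_eq_zero_iff hp).2 (by rw [hs, h])⟩
  have h2 : (besselFirstZero ν / 2) ^ 2 ≤ (2 * √x / 2) ^ 2 := by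
    have := hj.1.1
    gcongr
  linarith [hx.2]

/-! ### The Lamb constant -/

/-- The left-hand side of the Lamb equation in the variable `y = (c/m)²`, divided by `(c/m)^ν`. -/
noncomputable def lambSeries (ν m lam y : ℝ) : ℝ :=
  (1 + m * ν - 2 * lam) * besselSeries ν y - 2 * m * (y * besselSeries (ν + 1) y)

lemma continuous_lambSeries {ν : ℝ} (hν : 0 ≤ ν) (m lam : ℝ) : Continuous (lambSeries ν m lam) :=
  ((continuous_besselSeries hν).const_mul _).sub
    ((continuous_id.mul (continuous_besselSeries (by linarith))).const_mul _)

lemma lambSeries_zero_pos {ν m lam : ℝ} (hν : 0 ≤ ν) (hlam : lam < (1 + ν * m) / 2) :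
    0 < lambSeries ν m lam 0 := by
  simp only [lambSeries, zero_mul, mul_zero, sub_zero]
  exact mul_pos (by linarith) (besselSeries_zero_pos hν)

lemma lamb_equation_iff {ν m lam c : ℝ} (hν : 0 ≤ ν) (hm : 0 < m) (hc : 0 < c) :
    (1 - 2 * lam) * besselJ ν (2 / m * c) + 2 * c * deriv (besselJ ν) (2 / m * c) = 0 ↔
      lambSeries ν m lam ((c / m) ^ 2) = 0 := by
  have hz : 0 < 2 / m * c := by positivity
  have h1 := besselJ_eq (ν := ν) hz
  have h2 := mul_deriv_besselJ hν hz
  have h3 : 2 / m * c / 2 = c / m := by field_simp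
  rw [h3] at h1 h2
  have h4 : 2 * c * deriv (besselJ ν) (2 / m * c) =
      m * (2 / m * c * deriv (besselJ ν) (2 / m * c)) := by
    field_simp
  have h5 : (1 - 2 * lam) * besselJ ν (2 / m * c) + 2 * c * deriv (besselJ ν) (2 / m * c) =
      (c / m) ^ ν * lambSeries ν m lam ((c / m) ^ 2) := by
    rw [h4, h2, h1, lambSeries]
    ring
  rw [h5, mul_eq_zero, or_iff_right]
  exact (Real.rpow_pos_of_pos (by positivity) _).ne'

/-- Since `E_ν` vanishes at `Y = (j_ν/2)²`, the sign is that of `-E_{ν+1}(Y)`. -/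
lemma lambSeries_firstZero_neg {ν m : ℝ} (hν : 0 ≤ ν) (hν1 : ν ≤ 1) (hm : 0 < m) (lam : ℝ) :
    lambSeries ν m lam ((besselFirstZero ν / 2) ^ 2) < 0 := by
  have hj := (isLeast_besselFirstZero hν hν1).1
  have hY : 0 < (besselFirstZero ν / 2) ^ 2 := by
    have := hj.1
    positivity
  have h1 := besselSeries_succ_pos hν hY fun y hy =>
    besselSeries_pos hν hν1 (Set.Ioo_subset_Ico_self hy)
  rw [lambSeries, (besselJ_eq_zero_iff hj.1).1 hj.2, mul_zero, zero_sub, neg_lt_zero]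
  positivity

/-- The endpoints `0` and `j_ν` may be included because the Lamb equation fails there; hence the set
of roots is closed. -/
lemma lambRoots_eq {ν m lam : ℝ} (hν : 0 ≤ ν) (hν1 : ν ≤ 1) (hm : 0 < m)
    (hlam : lam < (1 + ν * m) / 2) :
    lambRoots ν m lam = {c | 2 / m * c ∈ Set.Icc 0 (besselFirstZero ν) ∧
      lambSeries ν m lam ((c / m) ^ 2) = 0} := by
  ext c
  constructor
  · rintro ⟨h1, h2⟩
    have hc : 0 < c := pos_of_mul_pos_right h1.1 (by positivity)
    exact ⟨Set.Ioo_subset_Icc_self h1, (lamb_equation_iff hν hm hc).1 h2⟩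
  · rintro ⟨h1, h2⟩
    have hc0 : 0 ≤ c := nonneg_of_mul_nonneg_right h1.1 (by positivity)
    have hc : 0 < c := by
      refine lt_of_le_of_ne hc0 fun h => ?_
      rw [← h] at h2
      simp only [zero_div, ne_eq, OfNat.ofNat_ne_zero, not_false_eq_true, zero_pow] at h2
      exact (lambSeries_zero_pos hν hlam).ne' h2
    refine ⟨⟨by positivity, lt_of_le_of_ne h1.2 fun h => ?_⟩, (lamb_equation_iff hν hm hc).2 h2⟩
    have h3 := lambSeries_firstZero_neg hν hν1 hm lam
    rw [← h, show 2 / m * c / 2 = c / m by field_simp] at h3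
    exact h3.ne h2

lemma isLeast_lambConstant {ν m lam : ℝ} (hν : 0 ≤ ν) (hν1 : ν ≤ 1) (hm : 0 < m)
    (hlam : lam < (1 + ν * m) / 2) :
    IsLeast (lambRoots ν m lam) (lambConstant ν m lam) := by
  have hbdd : BddBelow (lambRoots ν m lam) :=
    ⟨0, fun c hc => (pos_of_mul_pos_right hc.1.1 (by positivity)).le⟩
  refine ⟨IsClosed.csInf_mem ?_ ?_ hbdd, fun x hx => csInf_le hbdd hx⟩
  · rw [lambRoots_eq hν hν1 hm hlam]
    exact (isClosed_Icc.preimage (by fun_prop)).inter (isClosed_eq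
      ((continuous_lambSeries hν m lam).comp (by fun_prop)) continuous_const)
  · have hj := (isLeast_besselFirstZero hν hν1).1.1
    obtain ⟨y, hy, h⟩ := intermediate_value_Icc' (sq_nonneg (besselFirstZero ν / 2))
      (continuous_lambSeries hν m lam).continuousOn
      ⟨(lambSeries_firstZero_neg hν hν1 hm lam).le, (lambSeries_zero_pos hν hlam).le⟩
    refine ⟨m * √y, ?_⟩
    rw [lambRoots_eq hν hν1 hm hlam]
    refine ⟨⟨by positivity, ?_⟩, ?_⟩
    · have h1 : √y ≤ besselFirstZero ν / 2 := Real.sqrt_le_iff.2 ⟨by positivity, hy.2⟩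
      rw [show 2 / m * (m * √y) = 2 * √y by field_simp]
      linarith
    · rwa [mul_div_cancel_left₀ _ hm.ne', Real.sq_sqrt hy.1]

lemma lambSeries_pos {ν m lam y : ℝ} (hν : 0 ≤ ν) (hν1 : ν ≤ 1) (hm : 0 < m)
    (hlam : lam < (1 + ν * m) / 2) (hy : y ∈ Set.Ico 0 ((lambConstant ν m lam / m) ^ 2)) :
    0 < lambSeries ν m lam y := by
  have hc := isLeast_lambConstant hν hν1 hm hlam
  have hcm := hc.1
  rw [lambRoots_eq hν hν1 hm hlam] at hcm
  have hc0 : 0 ≤ lambConstant ν m lam := nonneg_of_mul_nonneg_right hcm.1.1 (by positivity)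
  refine pos_of_forall_ne_zero (continuous_lambSeries hν m lam) (lambSeries_zero_pos hν hlam)
    (fun x hx h => ?_) hy
  have h1 : √x < lambConstant ν m lam / m := (Real.sqrt_lt' (by
    refine lt_of_le_of_ne (by positivity) fun h0 => ?_
    rw [← h0] at hx
    norm_num at hx)).2 hx.2
  have h2 : m * √x < lambConstant ν m lam := by
    rw [lt_div_iff₀ hm] at h1
    linarith
  refine absurd (hc.2 ?_) h2.not_ge
  rw [lambRoots_eq hν hν1 hm hlam]
  refine ⟨⟨by positivity, le_trans ?_ hcm.1.2⟩, ?_⟩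
  · gcongr
  · rwa [mul_div_cancel_left₀ _ hm.ne', Real.sq_sqrt hx.1.le]

/-! ### The one-dimensional bound -/

/-- The function `ψ(t) = t Y'(t) / Y(t)` for the solution `Y(t) = √t J_ν((2c/m) t^{m/2})` of
`Y'' + ((1 - ν²m²)/(4t²) + c² t^{m-2}) Y = 0`, written through the entire functions `E_ν`. -/
noncomputable def lambLogDeriv (ν m c t : ℝ) : ℝ :=
  (1 + ν * m) / 2 - m * ((c / m) ^ 2 * t ^ m * besselSeries (ν + 1) ((c / m) ^ 2 * t ^ m) /
    besselSeries ν ((c / m) ^ 2 * t ^ m))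

/-- The Riccati equation `tψ' = ν²m²/4 - c²t^m - (ψ - 1/2)²`. -/
lemma hasDerivAt_lambLogDeriv {ν m c t : ℝ} (hν : 0 ≤ ν) (hm : 0 < m) (hc : 0 < c) (ht : 0 < t)
    (h0 : besselSeries ν ((c / m) ^ 2 * t ^ m) ≠ 0) :
    HasDerivAt (lambLogDeriv ν m c)
      ((ν ^ 2 * m ^ 2 / 4 - c ^ 2 * t ^ m - (lambLogDeriv ν m c t - 1 / 2) ^ 2) / t) t := by
  have htm : 0 < t ^ m := Real.rpow_pos_of_pos ht m
  have hy : 0 < (c / m) ^ 2 * t ^ m := by positivity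
  have h1 : HasDerivAt (fun t : ℝ => (c / m) ^ 2 * t ^ m) ((c / m) ^ 2 * (m * t ^ (m - 1))) t :=
    (Real.hasDerivAt_rpow_const (Or.inl ht.ne')).const_mul _
  have h2 := (((hasDerivAt_besselRatio hν hy h0).comp t h1).const_mul m).const_sub ((1 + ν * m) / 2)
  convert! h2 using 1
  rw [Real.rpow_sub_one ht.ne', lambLogDeriv]
  set r := (c / m) ^ 2 * t ^ m * besselSeries (ν + 1) ((c / m) ^ 2 * t ^ m) /
    besselSeries ν ((c / m) ^ 2 * t ^ m)
  field_simp
  ring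

/-- The pointwise bound that carries the Hardy inequality. With `ψ = lambLogDeriv` the function
`4ψ/t - 4λ - (4λ² + s)(1/t - 1) - 4c²(1 - t^{m-1})/(m-1)`, `s = 1 - ν²m²`, has derivative
`4(λ² - ψ²)/t² ≤ 0` and vanishes at `t = 1`. -/
lemma lamb_bound {ν m lam : ℝ} (hm : 1 < m) (hν : ν ∈ Set.Icc 0 (1 / m))
    (hlam : lam ∈ Set.Ico 0 ((1 + ν * m) / 2)) {t : ℝ} (ht : t ∈ Set.Ioc 0 1) :
    (1 - ν ^ 2 * m ^ 2) * (1 - t) +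
      4 * (lambConstant ν m lam ^ 2 + (m - 1) * (lam - lam ^ 2)) / (m - 1) * (t - t ^ m) ≤
    2 * (1 + ν * m) - 4 * lam ^ 2 := by
  have hm0 : 0 < m := by linarith
  have hm1 : 0 < m - 1 := by linarith
  have hν0 := hν.1
  have hνm : ν * m ≤ 1 := (le_div_iff₀ hm0).1 hν.2
  have hν1 : ν ≤ 1 := by nlinarith
  set c := lambConstant ν m lam with hcdef
  have hcl := isLeast_lambConstant hν0 hν1 hm0 hlam.2
  have hc : 0 < c := pos_of_mul_pos_right hcl.1.1.1 (by positivity)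
  have hcj : (c / m) ^ 2 < (besselFirstZero ν / 2) ^ 2 := by
    have h1 : c / m < besselFirstZero ν / 2 := by
      have := hcl.1.1.2
      rw [show 2 / m * lambConstant ν m lam = 2 * (c / m) by rw [hcdef]; ring] at this
      linarith
    have h2 : 0 < c / m := by positivity
    gcongr
  have hyle : ∀ t ∈ Set.Ioc (0 : ℝ) 1, (c / m) ^ 2 * t ^ m ≤ (c / m) ^ 2 := fun t ht =>
    mul_le_of_le_one_right (by positivity) (Real.rpow_le_one ht.1.le ht.2 hm0.le)
  have hy0 : ∀ t ∈ Set.Ioc (0 : ℝ) 1, 0 < (c / m) ^ 2 * t ^ m := fun t ht => by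
    have := Real.rpow_pos_of_pos ht.1 m
    positivity
  have hE : ∀ t ∈ Set.Ioc (0 : ℝ) 1, 0 < besselSeries ν ((c / m) ^ 2 * t ^ m) := fun t ht =>
    besselSeries_pos hν0 hν1 ⟨(hy0 t ht).le, (hyle t ht).trans_lt hcj⟩
  have hE1 : ∀ t ∈ Set.Ioc (0 : ℝ) 1, 0 < besselSeries (ν + 1) ((c / m) ^ 2 * t ^ m) := fun t ht =>
    besselSeries_succ_pos hν0 (hy0 t ht) fun y hy =>
      besselSeries_pos hν0 hν1 ⟨hy.1.le, hy.2.trans ((hyle t ht).trans_lt hcj)⟩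
  set ψ := lambLogDeriv ν m c with hψ
  have hψlam : ∀ t, 0 < t → t ≤ 1 → ψ t - lam = lambSeries ν m lam ((c / m) ^ 2 * t ^ m) /
      (2 * besselSeries ν ((c / m) ^ 2 * t ^ m)) := by
    intro t ht0 ht1
    have := (hE t ⟨ht0, ht1⟩).ne'
    rw [hψ, lambLogDeriv, lambSeries]
    generalize (c / m) ^ 2 * t ^ m = y at this ⊢
    field_simp
    ring
  have hroot : lambSeries ν m lam ((c / m) ^ 2) = 0 := (lamb_equation_iff hν0 hm0 hc).1 hcl.1.2
  -- `ψ ≥ λ`, because `t = 1` corresponds to the first root of the Lamb equation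
  have hlow : ∀ t ∈ Set.Ioc (0 : ℝ) 1, lam ≤ ψ t := by
    intro t ht
    rw [← sub_nonneg, hψlam t ht.1 ht.2]
    refine div_nonneg ?_ (mul_pos two_pos (hE t ht)).le
    rcases (hyle t ht).lt_or_eq with h | h
    · exact (lambSeries_pos hν0 hν1 hm0 hlam.2 ⟨(hy0 t ht).le, h⟩).le
    · rw [h, hroot]
  have hone : ψ 1 = lam := by
    rw [← sub_eq_zero, hψlam 1 one_pos le_rfl, Real.one_rpow, mul_one, hroot, zero_div]
  -- `ψ ≤ (1 + νm)/2`, because `E_{ν+1} > 0`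
  have hup : ψ t ≤ (1 + ν * m) / 2 := by
    have h1 := hE t ht
    have h2 := hE1 t ht
    have h3 := hy0 t ht
    rw [hψ, lambLogDeriv]
    exact sub_le_self _ (by positivity)
  set D : ℝ → ℝ := fun t => 4 * (ψ t / t) - 4 * lam -
    (4 * lam ^ 2 + (1 - ν ^ 2 * m ^ 2)) * (t⁻¹ - 1) - 4 * c ^ 2 / (m - 1) * (1 - t ^ (m - 1)) with hD
  have hDder : ∀ t ∈ Set.Ioc (0 : ℝ) 1, HasDerivAt D (4 * (lam ^ 2 - ψ t ^ 2) / t ^ 2) t := by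
    intro t ht
    have ht0 := ht.1
    have h1 := ((hasDerivAt_lambLogDeriv hν0 hm0 hc ht.1 (hE t ht).ne').div (hasDerivAt_id t)
      ht.1.ne').const_mul 4
    have h2 := ((hasDerivAt_inv ht.1.ne').sub_const 1).const_mul
      (4 * lam ^ 2 + (1 - ν ^ 2 * m ^ 2))
    have h3 := ((Real.hasDerivAt_rpow_const (x := t) (p := m - 1) (Or.inl ht.1.ne')).const_sub
      1).const_mul (4 * c ^ 2 / (m - 1))
    convert! ((h1.sub_const (4 * lam)).sub h2).sub h3 using 1
    rw [Real.rpow_sub_one ht.1.ne', Real.rpow_sub_one ht.1.ne']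
    simp only [id, ← hψ]
    field_simp
    ring
  have hanti : AntitoneOn D (Set.Ioc 0 1) := by
    refine antitoneOn_of_deriv_nonpos (convex_Ioc 0 1)
      (fun t ht => (hDder t ht).continuousAt.continuousWithinAt) ?_ ?_ <;>
    · intro t ht
      have ht' : t ∈ Set.Ioc (0 : ℝ) 1 := interior_subset ht
      first
      | exact (hDder t ht').differentiableAt.differentiableWithinAt
      | rw [(hDder t ht').deriv]
        have h1 := hlow t ht'
        have h2 := hlam.1
        exact div_nonpos_of_nonpos_of_nonneg (by nlinarith) (sq_nonneg t)
  have hD1 : D 1 = 0 := by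
    simp only [hD, hone, Real.one_rpow]
    ring
  have hDt : 0 ≤ D t := hD1 ▸ hanti ht ⟨one_pos, le_rfl⟩ ht.2
  have ht0 := ht.1
  have hmul : t * D t = 4 * ψ t - 4 * lam * t - (4 * lam ^ 2 + (1 - ν ^ 2 * m ^ 2)) * (1 - t) -
      4 * c ^ 2 / (m - 1) * (t - t ^ m) := by
    simp only [hD]
    rw [Real.rpow_sub_one ht.1.ne']
    field_simp
  have hmul0 : 0 ≤ t * D t := mul_nonneg ht0.le hDt
  have hK : 4 * (c ^ 2 + (m - 1) * (lam - lam ^ 2)) / (m - 1) * (t - t ^ m) =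
      4 * c ^ 2 / (m - 1) * (t - t ^ m) + 4 * (lam - lam ^ 2) * (t - t ^ m) := by
    field_simp
  have hll : 0 ≤ (lam - lam ^ 2) * t ^ m := by
    have h1 := hlam.1
    have h2 : lam ≤ 1 := by linarith [hlam.2]
    have := Real.rpow_pos_of_pos ht0 m
    refine mul_nonneg (by nlinarith) this.le
  rw [hK]
  nlinarith

/-! ### The distance to the complement of a convex set -/

lemma concaveOn_infDist_compl {E : Type*} [NormedAddCommGroup E] [NormedSpace ℝ E] {Ω : Set E}
    (hΩ : Convex ℝ Ω) : ConcaveOn ℝ Ω fun x => Metric.infDist x Ωᶜ := by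
  refine ⟨hΩ, fun x hx y hy a b ha hb hab => ?_⟩
  rcases Ωᶜ.eq_empty_or_nonempty with hne | hne
  · simp [hne]
  refine (Metric.le_infDist hne).2 fun w hw => ?_
  by_contra! hlt
  simp only [smul_eq_mul] at hlt
  set r := a * Metric.infDist x Ωᶜ + b * Metric.infDist y Ωᶜ with hr
  set v := w - (a • x + b • y) with hv
  have hvr : ‖v‖ < r := by rwa [hv, ← dist_eq_norm, dist_comm]
  have hr0 : 0 < r := (norm_nonneg v).trans_lt hvr
  have hmem : ∀ z ∈ Ω, z + (Metric.infDist z Ωᶜ / r) • v ∈ Ω := by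
    intro z hz
    by_contra hz'
    have h1 : Metric.infDist z Ωᶜ ≤ Metric.infDist z Ωᶜ / r * ‖v‖ := by
      refine (Metric.infDist_le_dist_of_mem hz').trans_eq ?_
      rw [dist_self_add_right, norm_smul,
        Real.norm_of_nonneg (div_nonneg Metric.infDist_nonneg hr0.le)]
    have h0 : Metric.infDist z Ωᶜ = 0 := by
      by_contra h0
      have hpos : 0 < Metric.infDist z Ωᶜ := lt_of_le_of_ne Metric.infDist_nonneg (Ne.symm h0)
      rw [div_mul_eq_mul_div, le_div_iff₀ hr0] at h1
      nlinarith
    rw [h0, zero_div, zero_smul, add_zero] at hz'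
    exact hz' hz
  refine hw ?_
  have h2 := hΩ (hmem x hx) (hmem y hy) ha hb hab
  convert! h2 using 1
  have h3 : a * (Metric.infDist x Ωᶜ / r) + b * (Metric.infDist y Ωᶜ / r) = 1 := by
    rw [mul_div_assoc', mul_div_assoc', ← add_div, ← hr, div_self hr0.ne']
  calc w = a • x + b • y + (1 : ℝ) • v := by rw [hv, one_smul]; abel
    _ = _ := by
      rw [← h3]
      module

lemma bdryDist_eq_infDist_compl {n : ℕ} {Ω : Set (EuclideanSpace ℝ (Fin n))} (hΩ : IsOpen Ω)
    (hΩu : Ω ≠ Set.univ) {x : EuclideanSpace ℝ (Fin n)} (hx : x ∈ Ω) :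
    bdryDist Ω x = Metric.infDist x Ωᶜ := by
  obtain ⟨y, hy, h⟩ := exists_mem_frontier_infDist_compl_eq_dist hx hΩu
  refine le_antisymm (h ▸ Metric.infDist_le_dist_of_mem hy) ?_
  refine Metric.infDist_le_infDist_of_subset (fun z hz hzΩ => ?_) ⟨y, hy⟩
  rw [hΩ.frontier_eq] at hz
  exact hz.2 hzΩ

/-- The distance function decreases at unit speed towards a nearest boundary point. -/
lemma one_le_norm_fderiv_infDist_compl {n : ℕ} {Ω : Set (EuclideanSpace ℝ (Fin n))} (hΩ : IsOpen Ω)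
    (hΩu : Ω ≠ Set.univ) {x : EuclideanSpace ℝ (Fin n)} (hx : x ∈ Ω)
    (hd : DifferentiableAt ℝ (fun x => Metric.infDist x Ωᶜ) x) :
    1 ≤ ‖fderiv ℝ (fun x => Metric.infDist x Ωᶜ) x‖ := by
  obtain ⟨y, hy, h⟩ := exists_mem_frontier_infDist_compl_eq_dist hx hΩu
  have hyc : y ∈ Ωᶜ := by
    rw [hΩ.frontier_eq] at hy
    exact hy.2
  set v := y - x with hv
  have hvn : Metric.infDist x Ωᶜ = ‖v‖ := by rw [h, dist_comm, dist_eq_norm]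
  have hv0 : 0 < ‖v‖ := by
    rw [norm_pos_iff, hv, sub_ne_zero]
    rintro rfl
    exact hyc hx
  have hline : ∀ t ∈ Set.Icc (0 : ℝ) 1, Metric.infDist (x + t • v) Ωᶜ = ‖v‖ - t * ‖v‖ := by
    intro t ht
    refine le_antisymm ?_ ?_
    · refine (Metric.infDist_le_dist_of_mem hyc).trans_eq ?_
      rw [dist_comm, dist_eq_norm, show y - (x + t • v) = (1 - t) • v by rw [hv]; module, norm_smul,
        Real.norm_of_nonneg (by linarith [ht.2])]
      ring
    · have h1 := Metric.infDist_le_infDist_add_dist (x := x) (y := x + t • v) (s := Ωᶜ)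
      rw [dist_self_add_right, norm_smul, Real.norm_of_nonneg ht.1, hvn] at h1
      linarith
  have h1 : HasDerivAt (fun t : ℝ => Metric.infDist (x + t • v) Ωᶜ)
      (fderiv ℝ (fun x => Metric.infDist x Ωᶜ) x v) 0 := hd.hasFDerivAt.hasLineDerivAt v
  have h2 : HasDerivAt (fun t : ℝ => ‖v‖ - t * ‖v‖) (-(1 * ‖v‖)) 0 :=
    ((hasDerivAt_id (0 : ℝ)).mul_const ‖v‖).const_sub _
  have hu : UniqueDiffWithinAt ℝ (Set.Icc (0 : ℝ) 1) 0 :=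
    uniqueDiffOn_Icc one_pos 0 ⟨le_rfl, zero_le_one⟩
  have h3 := hu.eq_deriv _ h1.hasDerivWithinAt
    (h2.hasDerivWithinAt.congr hline (hline 0 ⟨le_rfl, zero_le_one⟩))
  have h4 := (fderiv ℝ (fun x => Metric.infDist x Ωᶜ) x).le_opNorm v
  rw [h3, norm_neg, one_mul, norm_norm] at h4
  exact le_of_mul_le_mul_right (by linarith) hv0

/-! ### Superharmonicity of concave functions -/

section superharmonic

variable {E : Type*} [NormedAddCommGroup E] [NormedSpace ℝ E]

/-- Increments of a concave function over translates of a segment decrease along the segment. -/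
lemma ConcaveOn.sub_le_sub_of_translate {Ω : Set E} {d : E → ℝ} (hd : ConcaveOn ℝ Ω d) {x v : E}
    {t a b : ℝ} (ht : 0 < t) (hab : a ≤ b) (ha : x + a • v ∈ Ω) (hb : x + (b + t) • v ∈ Ω) :
    d (x + (b + t) • v) - d (x + b • v) ≤ d (x + (a + t) • v) - d (x + a • v) := by
  have hs : 0 < b - a + t := by linarith
  have h1 : (b - a) / (b - a + t) + t / (b - a + t) = 1 := by
    rw [← add_div, div_self hs.ne']
  have hp : 0 ≤ (b - a) / (b - a + t) := div_nonneg (by linarith) hs.le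
  have hq : 0 ≤ t / (b - a + t) := div_nonneg ht.le hs.le
  have h2 := hd.2 ha hb hp hq h1
  have h3 := hd.2 ha hb hq hp (by rw [add_comm, h1])
  have e1 : ((b - a) / (b - a + t)) • (x + a • v) + (t / (b - a + t)) • (x + (b + t) • v) =
      x + (a + t) • v := by
    have h4 : (b - a) / (b - a + t) * a + t / (b - a + t) * (b + t) = a + t := by
      field_simp
      ring
    calc _ = ((b - a) / (b - a + t) + t / (b - a + t)) • x +
        ((b - a) / (b - a + t) * a + t / (b - a + t) * (b + t)) • v := by module
      _ = _ := by rw [h1, h4, one_smul]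
  have e2 : (t / (b - a + t)) • (x + a • v) + ((b - a) / (b - a + t)) • (x + (b + t) • v) =
      x + b • v := by
    have h4 : t / (b - a + t) * a + (b - a) / (b - a + t) * (b + t) = b := by
      field_simp
      ring
    calc _ = ((b - a) / (b - a + t) + t / (b - a + t)) • x +
        (t / (b - a + t) * a + (b - a) / (b - a + t) * (b + t)) • v := by module
      _ = _ := by rw [h1, h4, one_smul]
  rw [e1] at h2
  rw [e2] at h3
  simp only [smul_eq_mul] at h2 h3
  have h5 : (b - a) / (b - a + t) = 1 - t / (b - a + t) := by linarith
  rw [h5] at h2 h3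
  linarith

lemma lineDeriv_eq_zero_of_notMem_tsupport {φ : E → ℝ} {x : E} (hx : x ∉ tsupport φ) (v : E) :
    lineDeriv ℝ φ x v = 0 := by
  have h : φ =ᶠ[nhds x] fun _ => 0 := notMem_tsupport_iff_eventuallyEq.1 hx
  rw [h.lineDeriv_eq]
  simp [lineDeriv]

variable [FiniteDimensional ℝ E] [MeasurableSpace E] [BorelSpace E] {μ : Measure E}
  [μ.IsAddHaarMeasure]

lemma LipschitzWith.integrable_lineDeriv_of_hasCompactSupport {φ : E → ℝ} {D : NNReal}
    (hφ : LipschitzWith D φ) (hφc : HasCompactSupport φ) (v : E) :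
    Integrable (fun x => lineDeriv ℝ φ x v) μ := by
  have h := (hφ.locallyIntegrable_lineDeriv (μ := μ) v).integrableOn_isCompact hφc
  refine (integrableOn_iff_integrable_of_support_subset fun x hx => ?_).1 h
  by_contra hx'
  exact hx (lineDeriv_eq_zero_of_notMem_tsupport hx' v)

lemma LipschitzWith.integrable_lineDeriv_mul_lineDeriv {d φ : E → ℝ} {C D : NNReal}
    (hd : LipschitzWith C d) (hφ : LipschitzWith D φ) (hφc : HasCompactSupport φ) (v : E) :
    Integrable (fun x => lineDeriv ℝ d x v * lineDeriv ℝ φ x v) μ :=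
  (hφ.integrable_lineDeriv_of_hasCompactSupport hφc v).bdd_mul
    (hd.memLp_lineDeriv (μ := μ) v).aestronglyMeasurable
    (.of_forall fun _ => norm_lineDeriv_le_of_lipschitz ℝ hd)

/-- A concave function is superharmonic in the weak sense, even separately in each direction: move
one derivative off `φ` onto a difference quotient of `d`, which decreases in its own direction. -/
lemma integral_lineDeriv_mul_lineDeriv_nonneg {Ω : Set E} {d φ : E → ℝ} {C D : NNReal}
    (hΩ : IsOpen Ω) (hd : LipschitzWith C d) (hdc : ConcaveOn ℝ Ω d)
    (hφ : LipschitzWith D φ) (hφc : HasCompactSupport φ) (hφ0 : ∀ x, 0 ≤ φ x)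
    (hφΩ : tsupport φ ⊆ Ω) (v : E) :
    0 ≤ ∫ x, lineDeriv ℝ d x v * lineDeriv ℝ φ x v ∂μ := by
  refine ge_of_tendsto (hd.integral_inv_smul_sub_mul_tendsto_integral_lineDeriv_mul
    (hφ.integrable_lineDeriv_of_hasCompactSupport hφc v) v) ?_
  obtain ⟨ε, hε, hεΩ⟩ := hφc.exists_thickening_subset_open hΩ hφΩ
  have hmem : ∀ x ∈ tsupport φ, ∀ s : ℝ, |s| * ‖v‖ < ε → x + s • v ∈ Ω := by
    intro x hx s hs
    refine hεΩ (Metric.mem_thickening_iff.2 ⟨x, hx, ?_⟩)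
    rwa [dist_self_add_left, norm_smul, Real.norm_eq_abs]
  set ρ := ε / (2 * (‖v‖ + 1)) with hρ
  have hρ0 : 0 < ρ := by positivity
  have hρv : 2 * ρ * ‖v‖ < ε := by
    rw [hρ]
    have : 2 * (ε / (2 * (‖v‖ + 1))) * ‖v‖ = ε * (‖v‖ / (‖v‖ + 1)) := by field_simp
    rw [this]
    exact mul_lt_of_lt_one_right hε ((div_lt_one (by positivity)).2 (by linarith))
  filter_upwards [Ioo_mem_nhdsGT hρ0] with t ht
  set q : E → ℝ := fun x => t⁻¹ • (d (x + t • v) - d x) with hq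
  have hshift : LipschitzWith 1 fun x : E => x + t • v :=
    LipschitzWith.of_dist_le_mul fun x y => by simp
  have hqL : LipschitzWith (‖t⁻¹‖₊ * (C * 1 + C)) q :=
    (lipschitzWith_smul t⁻¹).comp ((hd.comp hshift).sub hd)
  have hparts := hqL.integral_lineDeriv_mul_eq (μ := μ) hφ hφc (-v)
  simp only [neg_neg] at hparts
  have : ∫ x, t⁻¹ • (d (x + t • v) - d x) * lineDeriv ℝ φ x v ∂μ =
      ∫ x, lineDeriv ℝ φ x v * q x ∂μ := integral_congr_ae (.of_forall fun x => mul_comm _ _)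
  rw [this, ← hparts]
  refine integral_nonneg fun x => ?_
  by_cases hx : x ∈ tsupport φ
  · refine mul_nonneg ?_ (hφ0 x)
    rw [lineDeriv_neg, neg_nonneg, lineDeriv,
      ← derivWithin_of_mem_nhds (Ioo_mem_nhds (neg_lt_zero.2 hρ0) hρ0)]
    refine AntitoneOn.derivWithin_nonpos fun a ha b hb hab => ?_
    have hlt : ∀ s : ℝ, |s| < 2 * ρ → x + s • v ∈ Ω := fun s hs =>
      hmem x hx s ((mul_le_mul_of_nonneg_right hs.le (norm_nonneg v)).trans_lt hρv)
    have h := hdc.sub_le_sub_of_translate (x := x) (v := v) ht.1 hab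
      (hlt a (abs_lt.2 ⟨by linarith [ha.1], by linarith [ha.2]⟩))
      (hlt (b + t) (abs_lt.2 ⟨by linarith [hb.1, ht.1], by linarith [hb.2, ht.2]⟩))
    simp only [hq, add_assoc, ← add_smul]
    exact smul_le_smul_of_nonneg_left h (inv_nonneg.2 ht.1.le)
  · simp [image_eq_zero_of_notMem_tsupport hx]

end superharmonic

/-! ### Auxiliary inequalities -/

lemma exists_lipschitzWith_mul {E : Type*} [PseudoMetricSpace E] {u g : E → ℝ} {A B : NNReal}
    {M N : ℝ} (hu : LipschitzWith A u) (hg : LipschitzWith B g) (hM : ∀ x, |u x| ≤ M)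
    (hN : ∀ x, |g x| ≤ N) : ∃ C, LipschitzWith C fun x => u x * g x := by
  refine ⟨(M * B + A * N).toNNReal, LipschitzWith.of_dist_le_mul fun x y => ?_⟩
  have h1 := hu.dist_le_mul x y
  have h2 := hg.dist_le_mul x y
  have hM0 : 0 ≤ M := (abs_nonneg _).trans (hM x)
  rw [Real.dist_eq] at h1 h2 ⊢
  have h3 : |u x * (g x - g y)| ≤ M * (B * dist x y) := by
    rw [abs_mul]
    gcongr
    exact hM x
  have h4 : |(u x - u y) * g y| ≤ A * dist x y * N := by
    rw [abs_mul]
    gcongr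
    exact hN y
  have h5 : u x * g x - u y * g y = u x * (g x - g y) + (u x - u y) * g y := by ring
  rw [h5]
  refine (abs_add_le _ _).trans ((add_le_add h3 h4).trans ?_)
  have h6 := Real.le_coe_toNNReal (M * B + A * N)
  have h7 := mul_le_mul_of_nonneg_right h6 (dist_nonneg (x := x) (y := y))
  linarith

lemma exists_lipschitzWith_abs_rpow {E : Type*} [PseudoMetricSpace E] {f : E → ℝ} {A : NNReal}
    {M p : ℝ} (hp : 1 ≤ p) (hf : LipschitzWith A f) (hM : ∀ x, |f x| ≤ M) :
    ∃ C, LipschitzWith C fun x => |f x| ^ p := by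
  obtain ⟨C, hC⟩ := (Real.contDiff_rpow_const_of_le (p := p) (n := 1)
    (by exact_mod_cast hp)).contDiffOn.exists_lipschitzOnWith one_ne_zero (convex_Icc 0 M)
      isCompact_Icc
  have habs : LipschitzWith A fun x => |f x| := LipschitzWith.of_dist_le_mul fun x y => by
    rw [Real.dist_eq]
    exact (abs_abs_sub_abs_le _ _).trans (hf.dist_le_mul x y)
  refine ⟨C * A, ?_⟩
  have h := hC.comp (habs.lipschitzOnWith (s := Set.univ)) fun x _ => ⟨abs_nonneg _, hM x⟩
  exact lipschitzOnWith_univ.1 h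

/-- No differentiability of `|f|^p` is assumed: it fails at zeros of `f` when `p = 1`. -/
lemma norm_fderiv_abs_rpow_le {E : Type*} [NormedAddCommGroup E] [NormedSpace ℝ E] {f : E → ℝ}
    {x : E} {p : ℝ} (hp : 1 ≤ p) (hf : DifferentiableAt ℝ f x) :
    ‖fderiv ℝ (fun x => |f x| ^ p) x‖ ≤ p * |f x| ^ (p - 1) * ‖fderiv ℝ f x‖ := by
  by_cases h0 : f x = 0
  -- at a zero of `f` the function `|f|^p` has a minimum
  · have hmin : IsLocalMin (fun x => |f x| ^ p) x := .of_forall fun y => by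
      simp only [h0, abs_zero, Real.zero_rpow (show p ≠ 0 by linarith)]
      positivity
    rw [hmin.fderiv_eq_zero, norm_zero]
    positivity
  · have h1 := ((hasDerivAt_abs h0).comp_hasFDerivAt x hf.hasFDerivAt).rpow_const (p := p)
      (Or.inr hp)
    have h2 := h1.fderiv
    simp only [Function.comp_def] at h2
    rw [h2, norm_smul, norm_smul, Real.norm_of_nonneg (by positivity)]
    gcongr
    refine mul_le_of_le_one_left (norm_nonneg _) ?_
    rcases lt_or_gt_of_ne h0 with h | h <;> simp [h]

/-- Young's inequality with exponents `p/(p-1)` and `p`, in a form that includes `p = 1`. -/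
lemma rpow_sub_one_mul_le {a b p : ℝ} (ha : 0 ≤ a) (hb : 0 ≤ b) (hp : 1 ≤ p) :
    p * (a ^ (p - 1) * b) ≤ b ^ p + (p - 1) * a ^ p := by
  have hp0 : 0 < p := by linarith
  have h := Real.geom_mean_le_arith_mean2_weighted (w₁ := (p - 1) / p) (w₂ := 1 / p)
    (div_nonneg (by linarith) hp0.le) (by positivity) (Real.rpow_nonneg ha p)
    (Real.rpow_nonneg hb p) (by field_simp; ring)
  rw [← Real.rpow_mul ha, ← Real.rpow_mul hb, mul_div_cancel₀ _ hp0.ne',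
    mul_div_cancel₀ _ hp0.ne', Real.rpow_one] at h
  calc p * (a ^ (p - 1) * b) ≤ p * ((p - 1) / p * a ^ p + 1 / p * b ^ p) := by gcongr
    _ = _ := by field_simp; ring

/-- The inner product on the dual of a Hilbert space in orthonormal coordinates. -/
lemma sum_clm_mul_clm {ι E : Type*} [Fintype ι] [NormedAddCommGroup E] [InnerProductSpace ℝ E]
    [CompleteSpace E] (b : OrthonormalBasis ι ℝ E) (L M : StrongDual ℝ E) :
    ∑ i, L (b i) * M (b i) = inner ℝ ((InnerProductSpace.toDual ℝ E).symm L)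
      ((InnerProductSpace.toDual ℝ E).symm M) := by
  rw [← b.sum_inner_mul_inner]
  refine Finset.sum_congr rfl fun i _ => ?_
  rw [InnerProductSpace.toDual_symm_apply, real_inner_comm, InnerProductSpace.toDual_symm_apply]

lemma sum_clm_mul_clm_le {ι E : Type*} [Fintype ι] [NormedAddCommGroup E] [InnerProductSpace ℝ E]
    [CompleteSpace E] (b : OrthonormalBasis ι ℝ E) (L M : StrongDual ℝ E) :
    ∑ i, L (b i) * M (b i) ≤ ‖L‖ * ‖M‖ := by
  rw [sum_clm_mul_clm]
  exact (real_inner_le_norm _ _).trans_eq (by simp)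

lemma sum_clm_mul_self {ι E : Type*} [Fintype ι] [NormedAddCommGroup E] [InnerProductSpace ℝ E]
    [CompleteSpace E] (b : OrthonormalBasis ι ℝ E) (L : StrongDual ℝ E) :
    ∑ i, L (b i) * L (b i) = ‖L‖ ^ 2 := by
  rw [sum_clm_mul_clm, real_inner_self_eq_norm_sq]
  simp

lemma integrable_of_continuousOn_tsupport {E : Type*} [TopologicalSpace E] [T2Space E]
    [MeasurableSpace E] [OpensMeasurableSpace E] {μ : Measure E}
    [IsFiniteMeasureOnCompacts μ] {f : E → ℝ} (hf : HasCompactSupport f) {h : E → ℝ}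
    (hh : ContinuousOn h (tsupport f)) (h0 : ∀ x ∉ tsupport f, h x = 0) : Integrable h μ := by
  refine (integrableOn_iff_integrable_of_support_subset fun x hx => ?_).1
    (hh.integrableOn_compact hf)
  by_contra hx'
  exact hx (h0 x hx')

/-! ### The radial weight -/

/-- The primitive `G` of the weight `-(s/t² + 4K t^{m-2}/R^m)` that vanishes at `R`. -/
noncomputable def hardyPrimitive (s K m R t : ℝ) : ℝ :=
  s * (t⁻¹ - R⁻¹) + 4 * K / ((m - 1) * R ^ m) * (R ^ (m - 1) - t ^ (m - 1))

lemma hasDerivAt_hardyPrimitive {s K m R t : ℝ} (hm : 1 < m) (ht : 0 < t) :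
    HasDerivAt (hardyPrimitive s K m R) (-(s / t ^ 2 + 4 * K / R ^ m / t ^ (2 - m))) t := by
  have hm1 : m - 1 ≠ 0 := by linarith
  have h1 := ((hasDerivAt_inv ht.ne').sub_const R⁻¹).const_mul s
  have h2 := ((Real.hasDerivAt_rpow_const (x := t) (p := m - 1) (Or.inl ht.ne')).const_sub
    (R ^ (m - 1))).const_mul (4 * K / ((m - 1) * R ^ m))
  convert! h1.add h2 using 1
  rw [show m - 1 - 1 = -(2 - m) by ring, Real.rpow_neg ht.le, ← div_div]
  field_simp
  ring

lemma hardyPrimitive_nonneg {s K m R t : ℝ} (hs : 0 ≤ s) (hK : 0 ≤ K) (hm : 1 < m) (ht : 0 < t)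
    (htR : t ≤ R) : 0 ≤ hardyPrimitive s K m R t := by
  have h1 : R⁻¹ ≤ t⁻¹ := inv_anti₀ ht htR
  have h2 : t ^ (m - 1) ≤ R ^ (m - 1) := Real.rpow_le_rpow ht.le htR (by linarith)
  have h3 : 0 ≤ (m - 1) * R ^ m := mul_nonneg (by linarith) (Real.rpow_nonneg (ht.le.trans htR) m)
  exact add_nonneg (mul_nonneg hs (by linarith))
    (mul_nonneg (div_nonneg (by linarith) h3) (by linarith))

/-- The one-dimensional bound `hA` at `τ = t/R` says that `t G(t) ≤ A`. -/
lemma hardyPrimitive_le {s K m R A t : ℝ}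
    (hA : ∀ τ ∈ Set.Ioc (0 : ℝ) 1, s * (1 - τ) + 4 * K / (m - 1) * (τ - τ ^ m) ≤ A) (ht : 0 < t)
    (htR : t ≤ R) : hardyPrimitive s K m R t ≤ A / t := by
  have hR : 0 < R := ht.trans_le htR
  have h := hA (t / R) ⟨by positivity, (div_le_one hR).2 htR⟩
  rw [le_div_iff₀ ht]
  refine le_trans (le_of_eq ?_) h
  have hRm := (Real.rpow_pos_of_pos hR m).ne'
  rw [hardyPrimitive, Real.div_rpow ht.le hR.le, Real.rpow_sub_one hR.ne', Real.rpow_sub_one ht.ne',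
    ← div_div]
  field_simp

lemma exists_lipschitzOnWith_hardyPrimitive (s K m R : ℝ) {a : ℝ}
    (ha : 0 < a) (b : ℝ) : ∃ C, LipschitzOnWith C (hardyPrimitive s K m R) (Set.Icc a b) := by
  refine ContDiffOn.exists_lipschitzOnWith (n := 1) ?_ one_ne_zero (convex_Icc a b) isCompact_Icc
  have hne : ∀ t ∈ Set.Icc a b, t ≠ 0 := fun t ht => (ha.trans_le ht.1).ne'
  refine ContDiffOn.add ?_ ?_
  · exact contDiffOn_const.mul ((contDiffOn_id.inv hne).sub contDiffOn_const)
  · exact contDiffOn_const.mul (contDiffOn_const.sub (contDiffOn_id.rpow_const_of_ne hne))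

/-! ### The Hardy inequality in a convex domain -/

/-- The Hardy inequality derived from a one-dimensional bound `hA`. Test the superharmonicity of
the distance function against `|f|^p G(δ)`, then apply Young's inequality pointwise. -/
lemma hardy_of_bound {n : ℕ} {Ω : Set (EuclideanSpace ℝ (Fin n))} (hΩo : IsOpen Ω)
    (hΩc : Convex ℝ Ω) (hΩp : Ω ≠ Set.univ) (hΩi : FiniteInradius Ω) {p m s K A : ℝ} (hp : 1 ≤ p)
    (hm : 1 < m) (hs : 0 ≤ s) (hK : 0 ≤ K)
    (hA : ∀ τ ∈ Set.Ioc (0 : ℝ) 1, s * (1 - τ) + 4 * K / (m - 1) * (τ - τ ^ m) ≤ A)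
    {f : EuclideanSpace ℝ (Fin n) → ℝ} (hf : IsC01 Ω f) :
    p * (s * (∫ x in Ω, |f x| ^ p / bdryDist Ω x ^ 2) +
        4 * K / inradius Ω ^ m * ∫ x in Ω, |f x| ^ p / bdryDist Ω x ^ (2 - m)) ≤
      (p * A) ^ p * (∫ x in Ω, ‖∇ f x‖ ^ p / bdryDist Ω x ^ (2 - p)) +
        (p - 1) * ∫ x in Ω, |f x| ^ p / bdryDist Ω x ^ 2 := by
  have hp0 : 0 < p := by linarith
  have hA0 : 0 ≤ A := by simpa using hA 1 ⟨one_pos, le_rfl⟩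
  set d : EuclideanSpace ℝ (Fin n) → ℝ := fun x => Metric.infDist x Ωᶜ with hd
  have hdL : LipschitzWith 1 d := Metric.lipschitz_infDist_pt _
  have hbd : ∀ x ∈ Ω, bdryDist Ω x = d x := fun x hx => bdryDist_eq_infDist_compl hΩo hΩp hx
  have hdpos : ∀ x ∈ Ω, 0 < d x := fun x hx =>
    (hΩo.isClosed_compl.notMem_iff_infDist_pos (Set.nonempty_compl.2 hΩp)).1 (by simpa using hx)
  set R := inradius Ω with hR
  have hdR : ∀ x ∈ Ω, d x ≤ R := fun x hx =>
    hbd x hx ▸ le_csSup hΩi (Set.mem_image_of_mem _ hx)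
  obtain ⟨Cf, hfL⟩ := hf.contDiff.lipschitzWith_of_hasCompactSupport hf.hasCompactSupport
    one_ne_zero
  obtain ⟨M, hM⟩ := hf.contDiff.continuous.bounded_above_of_compact_support hf.hasCompactSupport
  obtain ⟨Cu, huL⟩ := exists_lipschitzWith_abs_rpow hp hfL hM
  set u : EuclideanSpace ℝ (Fin n) → ℝ := fun x => |f x| ^ p with hu
  have hu0 : ∀ x, 0 ≤ u x := fun x => by positivity
  have huM : ∀ x, |u x| ≤ M ^ p := fun x => by
    rw [abs_of_nonneg (hu0 x)]
    exact Real.rpow_le_rpow (abs_nonneg _) (hM x) hp0.le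
  have hfx : ∀ x ∉ tsupport f, f x = 0 := fun x hx => image_eq_zero_of_notMem_tsupport hx
  have hux : ∀ x ∉ tsupport f, u x = 0 := fun x hx => by
    simp [hu, hfx x hx, Real.zero_rpow hp0.ne']
  -- a globally Lipschitz function that agrees with `G` on the range of `d` over the support
  obtain ⟨ε, hε, hεd⟩ := hf.hasCompactSupport.isCompact.exists_forall_le'
    hdL.continuous.continuousOn fun x hx => hdpos x (hf.tsupport_subset hx)
  obtain ⟨C0, hC0⟩ := exists_lipschitzOnWith_hardyPrimitive s K m R (half_pos hε) (R + 1)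
  obtain ⟨η, hηL, hηG⟩ := hC0.extend_real
  have hdη : ∀ x ∈ tsupport f, η =ᶠ[nhds (d x)] hardyPrimitive s K m R := fun x hx =>
    (hηG.eventuallyEq_of_mem (Icc_mem_nhds (by linarith [hεd x hx])
      (by linarith [hdR x (hf.tsupport_subset hx)]))).symm
  have hηM : ∀ x, |η (d x)| ≤ |η 0| + C0 * |R| := by
    intro x
    have h1 := hηL.dist_le_mul (d x) 0
    rw [Real.dist_eq, Real.dist_eq, sub_zero] at h1
    have h2 : |d x| ≤ |R| := by
      by_cases hx : x ∈ Ω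
      · exact abs_le_abs_of_nonneg (hdpos x hx).le (hdR x hx)
      · simp [hd, Metric.infDist_zero_of_mem (show x ∈ Ωᶜ from hx)]
    have h3 : |η (d x)| ≤ |η 0| + |η (d x) - η 0| := by
      have := abs_add_le (η 0) (η (d x) - η 0)
      rwa [add_sub_cancel] at this
    have h4 : (C0 : ℝ) * |d x| ≤ C0 * |R| := by gcongr
    linarith
  obtain ⟨Cφ, hφL⟩ := exists_lipschitzWith_mul huL (hηL.comp hdL) huM hηM
  set φ : EuclideanSpace ℝ (Fin n) → ℝ := fun x => u x * (η ∘ d) x with hφ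
  have hφs : tsupport φ ⊆ tsupport f := closure_mono fun x hx hfx0 => hx (by
    simp [hφ, hu, hfx0, Real.zero_rpow hp0.ne'])
  have hφc : HasCompactSupport φ := hf.hasCompactSupport.mono' ((subset_tsupport φ).trans hφs)
  have hφ0 : ∀ x, 0 ≤ φ x := by
    intro x
    by_cases hx : x ∈ tsupport f
    · refine mul_nonneg (hu0 x) ?_
      have hxΩ := hf.tsupport_subset hx
      rw [Function.comp, (hdη x hx).eq_of_nhds]
      exact hardyPrimitive_nonneg hs hK hm (hdpos x hxΩ) (hdR x hxΩ)
    · simp [hφ, hux x hx]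
  -- `S = ⟪∇d, ∇φ⟫` almost everywhere
  set b := stdOrthonormalBasis ℝ (EuclideanSpace ℝ (Fin n))
  set S : EuclideanSpace ℝ (Fin n) → ℝ := fun x =>
    ∑ i, lineDeriv ℝ d x (b i) * lineDeriv ℝ φ x (b i) with hS
  have hSint : Integrable S := integrable_finsetSum _ fun i _ =>
    hdL.integrable_lineDeriv_mul_lineDeriv hφL hφc (b i)
  have hSnonneg : 0 ≤ ∫ x in Ω, S x := by
    rw [setIntegral_eq_integral_of_forall_compl_eq_zero fun x hx => Finset.sum_eq_zero fun i _ => by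
      rw [lineDeriv_eq_zero_of_notMem_tsupport
        (fun h => hx (hf.tsupport_subset (hφs h))), mul_zero]]
    rw [integral_finsetSum _ fun i _ => hdL.integrable_lineDeriv_mul_lineDeriv hφL hφc (b i)]
    exact Finset.sum_nonneg fun i _ => integral_lineDeriv_mul_lineDeriv_nonneg hΩo hdL
      (concaveOn_infDist_compl hΩc) hφL hφc hφ0 (hφs.trans hf.tsupport_subset) (b i)
  have hcd : ContinuousOn d (tsupport f) := hdL.continuous.continuousOn
  have hcu : ContinuousOn u (tsupport f) := huL.continuous.continuousOn
  have hbd' : Set.EqOn (bdryDist Ω) d (tsupport f) := fun x hx => hbd x (hf.tsupport_subset hx)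
  have hcb : ContinuousOn (bdryDist Ω) (tsupport f) := hcd.congr hbd'
  have hbne : ∀ x ∈ tsupport f, bdryDist Ω x ≠ 0 := fun x hx => by
    rw [hbd' hx]
    exact (hdpos x (hf.tsupport_subset hx)).ne'
  have hbrne : ∀ (q : ℝ), ∀ x ∈ tsupport f, bdryDist Ω x ^ q ≠ 0 := fun q x hx => by
    rw [hbd' hx]
    exact (Real.rpow_pos_of_pos (hdpos x (hf.tsupport_subset hx)) q).ne'
  have hI1 : Integrable fun x => |f x| ^ p / bdryDist Ω x ^ 2 :=
    integrable_of_continuousOn_tsupport hf.hasCompactSupport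
      (hcu.div (hcb.pow 2) fun x hx => pow_ne_zero 2 (hbne x hx)) fun x hx => by
        have := hux x hx
        simp only [hu] at this
        rw [this, zero_div]
  have hI2 : Integrable fun x => |f x| ^ p / bdryDist Ω x ^ (2 - m) :=
    integrable_of_continuousOn_tsupport hf.hasCompactSupport
      (hcu.div (hcb.rpow_const fun x hx => Or.inl (hbne x hx)) (hbrne _)) fun x hx => by
        have := hux x hx
        simp only [hu] at this
        rw [this, zero_div]
  have hgrad : ∀ x, ‖∇ f x‖ = ‖fderiv ℝ f x‖ := fun x => by simp [gradient]
  have hfd0 : ∀ x ∉ tsupport f, fderiv ℝ f x = 0 := fun x hx => by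
    have h : f =ᶠ[nhds x] fun _ => 0 := notMem_tsupport_iff_eventuallyEq.1 hx
    rw [h.fderiv_eq]
    simp
  have hI3 : Integrable fun x => ‖∇ f x‖ ^ p / bdryDist Ω x ^ (2 - p) := by
    simp only [hgrad]
    refine integrable_of_continuousOn_tsupport hf.hasCompactSupport
      (ContinuousOn.div ?_ (hcb.rpow_const fun x hx => Or.inl (hbne x hx)) (hbrne _)) fun x hx => by
        rw [hfd0 x hx, norm_zero, Real.zero_rpow hp0.ne', zero_div]
    exact ((hf.contDiff.continuous_fderiv one_ne_zero).norm.rpow_const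
      fun _ => Or.inr hp0.le).continuousOn
  have hpt : ∀ᵐ x, x ∈ Ω → p * S x ≤ (p * A) ^ p * (‖∇ f x‖ ^ p / bdryDist Ω x ^ (2 - p)) +
      (p - 1) * (|f x| ^ p / bdryDist Ω x ^ 2) - p * (s * (|f x| ^ p / bdryDist Ω x ^ 2) +
        4 * K / R ^ m * (|f x| ^ p / bdryDist Ω x ^ (2 - m))) := by
    filter_upwards [hdL.ae_differentiableAt, huL.ae_differentiableAt] with x hdx hux' hxΩ
    by_cases hx : x ∈ tsupport f
    · rw [hbd x hxΩ, hgrad]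
      have hδ := hdpos x hxΩ
      set δ := d x with hδdef
      set G := hardyPrimitive s K m R δ with hGdef
      set W := s / δ ^ 2 + 4 * K / R ^ m / δ ^ (2 - m) with hW
      have hG0 : 0 ≤ G := hardyPrimitive_nonneg hs hK hm hδ (hdR x hxΩ)
      have hGA : G ≤ A / δ := hardyPrimitive_le hA hδ (hdR x hxΩ)
      have hηd : HasDerivAt η (-W) (d x) :=
        (hasDerivAt_hardyPrimitive hm hδ).congr_of_eventuallyEq (hdη x hx)
      have hηx : (η ∘ d) x = G := (hdη x hx).eq_of_nhds
      have hφx := hux'.hasFDerivAt.mul (hηd.comp_hasFDerivAt x hdx.hasFDerivAt)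
      have hSx : S x = G * ∑ i, fderiv ℝ d x (b i) * fderiv ℝ u x (b i) -
          u x * W * ∑ i, fderiv ℝ d x (b i) * fderiv ℝ d x (b i) := by
        rw [Finset.mul_sum, Finset.mul_sum, ← Finset.sum_sub_distrib]
        refine Finset.sum_congr rfl fun i _ => ?_
        have h1 : lineDeriv ℝ φ x (b i) = _ := (hφx.hasLineDerivAt (b i)).lineDeriv
        rw [h1, hdx.lineDeriv_eq_fderiv, hηx]
        simp only [add_apply, smul_apply, smul_eq_mul]
        ring
      have hd1 : ‖fderiv ℝ d x‖ ≤ 1 := by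
        simpa using norm_fderiv_le_of_lipschitz ℝ (x₀ := x) hdL
      have hd2 : 1 ≤ ‖fderiv ℝ d x‖ := one_le_norm_fderiv_infDist_compl hΩo hΩp hxΩ hdx
      have hW0 : 0 ≤ W := by
        have := Real.rpow_nonneg (hδ.le.trans (hdR x hxΩ)) m
        positivity
      have hdu := sum_clm_mul_clm_le b (fderiv ℝ d x) (fderiv ℝ u x)
      have hun : ‖fderiv ℝ u x‖ ≤ p * |f x| ^ (p - 1) * ‖fderiv ℝ f x‖ :=
        norm_fderiv_abs_rpow_le hp ((hf.contDiff.differentiable one_ne_zero) x)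
      have h1 : ∑ i, fderiv ℝ d x (b i) * fderiv ℝ u x (b i) ≤
          p * |f x| ^ (p - 1) * ‖fderiv ℝ f x‖ :=
        hdu.trans ((mul_le_of_le_one_left (norm_nonneg _) hd1).trans hun)
      have h2 : 1 ≤ ∑ i, fderiv ℝ d x (b i) * fderiv ℝ d x (b i) := by
        rw [sum_clm_mul_self]
        exact one_le_pow₀ hd2
      have h3 : S x ≤ A / δ * (p * |f x| ^ (p - 1) * ‖fderiv ℝ f x‖) - u x * W := by
        rw [hSx]
        have h4 := mul_le_mul_of_nonneg_left h1 hG0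
        have h5 := mul_le_mul_of_nonneg_left h2 (mul_nonneg (hu0 x) hW0)
        have h6 := mul_le_mul_of_nonneg_right hGA
          (show 0 ≤ p * |f x| ^ (p - 1) * ‖fderiv ℝ f x‖ by positivity)
        linarith
      have hY := rpow_sub_one_mul_le (a := |f x|) (b := p * A * (δ * ‖fderiv ℝ f x‖))
        (abs_nonneg _) (by positivity) hp
      rw [Real.mul_rpow (by positivity) (by positivity),
        Real.mul_rpow hδ.le (norm_nonneg _)] at hY
      have hδp : δ ^ (2 - p) = δ ^ 2 / δ ^ p := by
        rw [Real.rpow_sub hδ, Real.rpow_two]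
      have hδp0 := Real.rpow_pos_of_pos hδ p
      calc p * S x ≤ p * (A / δ * (p * |f x| ^ (p - 1) * ‖fderiv ℝ f x‖) - u x * W) := by gcongr
        _ = p * (|f x| ^ (p - 1) * (p * A * (δ * ‖fderiv ℝ f x‖))) / δ ^ 2 - p * (u x * W) := by
          field_simp
        _ ≤ ((p * A) ^ p * (δ ^ p * ‖fderiv ℝ f x‖ ^ p) + (p - 1) * |f x| ^ p) / δ ^ 2 -
            p * (u x * W) := by gcongr
        _ = _ := by
          rw [hδp, hW, hu]
          field_simp
    · have hS0 : S x = 0 := Finset.sum_eq_zero fun i _ => by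
        rw [lineDeriv_eq_zero_of_notMem_tsupport (fun h => hx (hφs h)), mul_zero]
      rw [hS0, hgrad, hfd0 x hx, hfx x hx]
      simp [Real.zero_rpow hp0.ne']
  have hJ3 := hI3.const_mul ((p * A) ^ p)
  have hJ1 := hI1.const_mul (p - 1)
  have hX : Integrable fun x => (p * A) ^ p * (‖∇ f x‖ ^ p / bdryDist Ω x ^ (2 - p)) +
      (p - 1) * (|f x| ^ p / bdryDist Ω x ^ 2) := hJ3.add hJ1
  have hs1 := hI1.const_mul s
  have hK2 := hI2.const_mul (4 * K / R ^ m)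
  have hY : Integrable fun x => p * (s * (|f x| ^ p / bdryDist Ω x ^ 2) +
      4 * K / R ^ m * (|f x| ^ p / bdryDist Ω x ^ (2 - m))) := (hs1.add hK2).const_mul p
  have hint := setIntegral_mono_ae_restrict (hSint.const_mul p).integrableOn
    (hX.sub hY).integrableOn ((ae_restrict_iff' hΩo.measurableSet).2 hpt)
  simp only [Pi.sub_apply] at hint
  rw [integral_const_mul, integral_sub hX.integrableOn hY.integrableOn,
    integral_add hJ3.integrableOn hJ1.integrableOn, integral_const_mul, integral_const_mul,
    integral_const_mul, integral_add hs1.integrableOn hK2.integrableOn, integral_const_mul,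
    integral_const_mul] at hint
  have := mul_nonneg hp0.le hSnonneg
  linarith

theorem theorem6 {n : ℕ} (Ω : Set (EuclideanSpace ℝ (Fin n)))
    (hΩo : IsOpen Ω) (hΩc : Convex ℝ Ω) (hΩp : Ω ≠ Set.univ) (hΩi : FiniteInradius Ω)
    (p m ν lam : ℝ) (hp : 1 ≤ p) (hm : 1 < m) (hν : ν ∈ Set.Icc 0 (1 / m))
    (hlam : lam ∈ Set.Ico 0 ((1 + ν * m) / 2)) :
    IsLeast (besselPosZeros ν) (besselFirstZero ν) ∧
    IsLeast (lambRoots ν m lam) (lambConstant ν m lam) ∧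
    ∀ f : EuclideanSpace ℝ (Fin n) → ℝ, IsC01 Ω f →
      ((1 - p * ν ^ 2 * m ^ 2) * (∫ x in Ω, |f x| ^ p / bdryDist Ω x ^ 2) +
          4 * p * (lambConstant ν m lam ^ 2 + (m - 1) * (lam - lam ^ 2)) / inradius Ω ^ m *
            (∫ x in Ω, |f x| ^ p / bdryDist Ω x ^ (2 - m)) ≤
        p ^ p * (2 * (1 + ν * m) - 4 * lam ^ 2) ^ p *
          (∫ x in Ω, ‖∇ f x‖ ^ p / bdryDist Ω x ^ (2 - p))) ∧
      (ν < 1 / m →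
        (∫ x in Ω, |f x| ^ p / bdryDist Ω x ^ 2) +
          4 * p * (lambConstant ν m lam ^ 2 + (m - 1) * (lam - lam ^ 2)) /
              ((1 - ν ^ 2 * m ^ 2) * inradius Ω ^ m) *
            (∫ x in Ω, |f x| ^ p / bdryDist Ω x ^ (2 - m)) ≤
        p ^ p * (2 / (1 - ν * m) - 4 * lam ^ 2 / (1 - ν ^ 2 * m ^ 2)) ^ p *
          (∫ x in Ω, ‖∇ f x‖ ^ p / bdryDist Ω x ^ (2 - p))) := by
  have hm0 : 0 < m := by linarith
  have hνm : ν * m ≤ 1 := (le_div_iff₀ hm0).1 hν.2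
  have hνm0 : 0 ≤ ν * m := mul_nonneg hν.1 hm0.le
  have hν1 : ν ≤ 1 := by nlinarith [hν.1]
  have hlam1 : lam ≤ 1 := by linarith [hlam.2]
  have hll : 0 ≤ lam - lam ^ 2 := by nlinarith [hlam.1]
  set c := lambConstant ν m lam
  set K := c ^ 2 + (m - 1) * (lam - lam ^ 2) with hK
  set A := 2 * (1 + ν * m) - 4 * lam ^ 2 with hA
  have hK0 : 0 ≤ K := add_nonneg (sq_nonneg _) (mul_nonneg (by linarith) hll)
  have hbound : ∀ τ ∈ Set.Ioc (0 : ℝ) 1, (1 - ν ^ 2 * m ^ 2) * (1 - τ) +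
      4 * K / (m - 1) * (τ - τ ^ m) ≤ A := fun τ hτ => lamb_bound hm hν hlam hτ
  have hA0 : 0 ≤ A := by simpa using hbound 1 ⟨one_pos, le_rfl⟩
  have hs0 : 0 ≤ 1 - ν ^ 2 * m ^ 2 := by nlinarith
  refine ⟨isLeast_besselFirstZero hν.1 hν1, isLeast_lambConstant hν.1 hν1 hm0 hlam.2,
    fun f hf => ⟨?_, fun hνlt => ?_⟩⟩
  · have h := hardy_of_bound hΩo hΩc hΩp hΩi hp hm hs0 hK0 hbound hf
    rw [Real.mul_rpow (by linarith) hA0] at h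
    refine le_trans (le_of_eq ?_) (sub_le_iff_le_add.2 h)
    ring
  · have hνmlt : ν * m < 1 := (lt_div_iff₀ hm0).1 hνlt
    have hs1 : 0 < 1 - ν ^ 2 * m ^ 2 := by nlinarith
    -- dividing the one-dimensional bound by `1 - ν²m²` leaves the coefficient
    -- `p - (p - 1) = 1` after Young's inequality
    have hbound' : ∀ τ ∈ Set.Ioc (0 : ℝ) 1, 1 * (1 - τ) +
        4 * (K / (1 - ν ^ 2 * m ^ 2)) / (m - 1) * (τ - τ ^ m) ≤ A / (1 - ν ^ 2 * m ^ 2) := by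
      intro τ hτ
      rw [le_div_iff₀ hs1]
      refine le_trans (le_of_eq ?_) (hbound τ hτ)
      have : m - 1 ≠ 0 := by linarith
      field_simp
    have h := hardy_of_bound hΩo hΩc hΩp hΩi hp hm zero_le_one (div_nonneg hK0 hs0) hbound' hf
    rw [Real.mul_rpow (by linarith) (div_nonneg hA0 hs0)] at h
    have hAeq : 2 / (1 - ν * m) - 4 * lam ^ 2 / (1 - ν ^ 2 * m ^ 2) = A / (1 - ν ^ 2 * m ^ 2) := by
      have h1 : 1 - ν * m ≠ 0 := by linarith
      have h2 : 1 + ν * m ≠ 0 := by linarith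
      rw [hA, show 1 - ν ^ 2 * m ^ 2 = (1 - ν * m) * (1 + ν * m) by ring]
      field_simp
    rw [hAeq]
    refine le_trans (le_of_eq ?_) (sub_le_iff_le_add.2 h)
    rw [← div_div]
    ring
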